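/- Let $\Sigma$ be a finite alphabet. A finite state automaton (FSA) over $\Sigma$ has finitely many states, sets of initial and accepting states, and transitions labelled by elements of $\Sigma\cup\{\varepsilon\}$. A transducer $T$ over $\Sigma$ is a finite state automaton over the alphabet $(\Sigma\cup\{\varepsilon\})\times(\Sigma\cup\{\varepsilon\})$; it recognizes the relation $R(T)\subseteq\Sigma^*\times\Sigma^*$ of all pairs $(a_1\cdots a_\ell,\; b_1\cdots b_\ell)$ such that $T$ accepts the word $(a_1,b_1)\cdots(a_\ell,b_\ell)$. A string constraint over $\Sigma$ and the string variables $x_1,\dots,x_n$ is a finite conjunction of membership constraints $x\in L(A)$, with $x$ a variable and $A$ an FSA over $\Sigma$, and relational constraints $(t',t)\in R(T)$, with $t',t$ concatenations of variables and $T$ a transducer over $\Sigma$. Its language $L(\Psi)\subseteq(\Sigma^*)^n$ is the set of all $(u_1,\dots,u_n)$ such that assigning $u_i$ to $x_i$ makes $\Psi$ true. The constraint $\Psi$ is straight-line (SL) if, up to the order of its conjuncts, it is $\Psi_0\wedge\bigwedge_{i=1}^{k}\bigl((y_i,t_i)\in R(T_i)\bigr)$, where $\Psi_0$ is a conjunction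 of membership constraints, $y_1,\dots,y_n$ is an enumeration of the variables without repetition, $k\le n$, and every variable $y_j$ that occurs in $t_i$ satisfies $j>i$. A set $R\subseteq(\Sigma^*)^n$ is in $\mathsf{REG}$ if $R=\bigcup_{i=1}^{k}L_{i,1}\times\cdots\times L_{i,n}$ for some $k\in\mathbb N$ and regular languages $L_{i,j}\subseteq\Sigma^*$. Two constraints $\Psi,\Psi'$ over $\Sigma$ and $x_1,\dots,x_n$ are $\mathsf{REG}$-separable if there is a set $R$ in $\mathsf{REG}$ with $L(\Psi)\subseteq R$ and $R\cap L(\Psi')=\emptyset$. **Theorem.** The $\mathsf{REG}$-separability problem is undecidable even for straight-line string constraints: there are a finite alphabet $\Sigma$ and a number $n$ of string variables such that no algorithm decides, given two SL string constraints $\Psi,\Psi'$ over $\Sigma$ and $x_1,\dots,x_n$, whether $\Psi$ and $\Psi'$ are $\mathsf{REG}$-separable. (In particular the problem is undecidable when $\Sigma$ and $n$ are part of the input, and for general string constraints.) -/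

import Mathlib

namespace StringConstraints

/-- A finite state automaton over the alphabet `α`, presented as finite data: the states are natural
numbers (only the finitely many that are listed matter), and a transition `(p, a, q)` is labelled by
a letter `some a` or by the empty word `none`. -/
structure FSA (α : Type) where
  transitions : List (ℕ × Option α × ℕ)
  initial : List ℕ
  accepting : List ℕ

namespace FSA

variable {α : Type}

/-- The automaton as an automaton with `ε`-transitions in the sense of Mathlib. -/
def toεNFA (A : FSA α) : εNFA α ℕ where
  step p a := {q | (p, a, q) ∈ A.transitions}
  start := {q | q ∈ A.initial}
  accept := {q | q ∈ A.accepting}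

/-- The language `L(A)`. -/
def language (A : FSA α) : Language α := A.toεNFA.accepts

def equivProd (α : Type) :
    FSA α ≃ List (ℕ × Option α × ℕ) × List ℕ × List ℕ where
  toFun A := (A.transitions, A.initial, A.accepting)
  invFun p := ⟨p.1, p.2.1, p.2.2⟩
  left_inv _ := rfl
  right_inv _ := rfl

instance [Primcodable α] : Primcodable (FSA α) := Primcodable.ofEquiv _ (equivProd α)

end FSA

/-- A transducer over `α`: a 2-tape automaton, that is, an automaton over the alphabet
`(α ∪ {ε}) × (α ∪ {ε})`. -/
abbrev Transducer (α : Type) : Type := FSA (Option α × Option α)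

/-- The relation `R(T)` recognized by a transducer: the pairs of words that are spelled on the two
tapes by an accepted word over `(α ∪ {ε}) × (α ∪ {ε})`. -/
def Transducer.relation {α : Type} (T : Transducer α) : Set (List α × List α) :=
  {w | ∃ u ∈ T.language,
    w.1 = (u.map Prod.fst).reduceOption ∧ w.2 = (u.map Prod.snd).reduceOption}

/-- A string term over the variables `x_0, …, x_{n-1}`: a concatenation of variables. -/
abbrev Term (n : ℕ) : Type := List (Fin n)

/-- Atomic string constraints over the alphabet `α` and `n` string variables:
`member x A` is `x ∈ L(A)`, and `related t' t T` is `(t', t) ∈ R(T)`. -/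
inductive Atomic (α : Type) (n : ℕ) where
  | member (x : Fin n) (A : FSA α)
  | related (t' t : Term n) (T : Transducer α)

namespace Atomic

def equivSum (α : Type) (n : ℕ) :
    Atomic α n ≃ (Fin n × FSA α) ⊕ (Term n × Term n × Transducer α) where
  toFun
    | member x A => Sum.inl (x, A)
    | related t' t T => Sum.inr (t', t, T)
  invFun
    | Sum.inl (x, A) => member x A
    | Sum.inr (t', t, T) => related t' t T
  left_inv c := by cases c <;> rfl
  right_inv c := by rcases c with ⟨_, _⟩ | ⟨_, _, _⟩ <;> rfl

instance {α : Type} [Primcodable α] {n : ℕ} : Primcodable (Atomic α n) :=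
  Primcodable.ofEquiv _ (equivSum α n)

end Atomic

/-- A string constraint: a finite conjunction of atomic string constraints. -/
abbrev Constraint (α : Type) (n : ℕ) : Type := List (Atomic α n)

/-- The value of a term under an evaluation `η` of the variables. -/
def Term.eval {α : Type} {n : ℕ} (η : Fin n → List α) (t : Term n) : List α := t.flatMap η

/-- The evaluation `η` satisfies an atomic constraint. -/
def Atomic.Holds {α : Type} {n : ℕ} (η : Fin n → List α) : Atomic α n → Prop
  | .member x A => η x ∈ A.language
  | .related t' t T => (Term.eval η t', Term.eval η t) ∈ Transducer.relation T

/-- The language `L(Ψ)`: the set of `n`-tuples of words that are solutions of `Ψ`. -/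
def Constraint.language {α : Type} {n : ℕ} (Ψ : Constraint α n) : Set (Fin n → List α) :=
  {η | ∀ c ∈ Ψ, c.Holds η}

/-- Straight-line constraints: up to the order of the conjuncts, `Ψ` consists of membership
constraints and of relational constraints `(x_i, t_i) ∈ R(T_i)`, `i < k`, for an enumeration
`x_0, …, x_{n-1}` of the variables without repetition and some `k ≤ n`, where a variable `x_j` may
occur in `t_i` only if `i < j`. -/
def Constraint.IsStraightLine {α : Type} {n : ℕ} (Ψ : Constraint α n) : Prop :=
  ∃ (x : Equiv.Perm (Fin n)) (k : ℕ) (hk : k ≤ n) (M : List (Fin n × FSA α))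
    (t : Fin k → Term n) (T : Fin k → Transducer α),
    List.Perm Ψ (M.map (fun p => Atomic.member p.1 p.2) ++
      List.ofFn (fun i => Atomic.related [x (Fin.castLE hk i)] (t i) (T i))) ∧
    ∀ (i : Fin k) (j : Fin n), x j ∈ t i → Fin.castLE hk i < j

/-- The class `REG` of sets of `n`-tuples of words: finite unions of products of regular
languages. -/
def IsREG {α : Type} {n : ℕ} (R : Set (Fin n → List α)) : Prop :=
  ∃ (k : ℕ) (L : Fin k → Fin n → Language α),
    (∀ i j, (L i j).IsRegular) ∧ R = {u | ∃ i, ∀ j, u j ∈ L i j}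

/-- `Ψ` and `Ψ'` are `REG`-separable. -/
def REGSeparable {α : Type} {n : ℕ} (Ψ Ψ' : Constraint α n) : Prop :=
  ∃ R : Set (Fin n → List α), IsREG R ∧ Ψ.language ⊆ R ∧ R ∩ Ψ'.language = ∅

end StringConstraints

/-!
The halting problem of a fixed Turing machine is reduced to `REG`-separability of two straight-line
constraints in the variables `z, x, v, y`.

Configurations of the machine are written as words, with the state placed at the scanned letter,
and a step adds a blank at both ends, so that it only replaces a factor of three letters around the
head. Therefore the relation between a configuration and its successor is rational
(`WordCfg.isRational_blockStep`), and so is its star with respect to concatenation, configurations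
being terminated by a separator. The first constraint says that `y` arises from the sequence of
configurations `x` by performing one step everywhere, and that `z` and `x` have the same length.
The second one says that `x` is a prefix of `v y`, where `v` is the word of the initial
configuration, and that `z` is longer than `x`. Only `v` depends on the input of the machine, and
this makes the reduction computable.

If the machine does not halt, take for `x` the first `n` configurations of the run. For every `n`
this solves the first constraint, and if `z` is made longer, it solves the second one. As only
finitely many products of languages are available, two lengths of `z` that belong to different `n`
cannot be told apart by any of them, so the constraints are not separable
(`not_REGSeparable_of_infinite`). If the machine halts, then a pair of solutions that agree on
sufficiently long prefixes would force `x` in the first one to contain the whole run, although the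
last configuration has no successor; so finitely many prefixes separate the constraints
(`REGSeparable_of_finite`).

Rationality is obtained from the closure of regular languages under concatenation and star, for
which the finiteness of the set of left quotients is verified. The machine is obtained from a
universal partial recursive function by the compilation chain of Mathlib, restricted to the finite
set of states that it uses (`exists_turingMachine_halting_undecidable`).
-/

/-! ### Closure properties of regular languages -/

namespace Language

variable {β : Type}

/-- Whether `x ++ y` has its first `N` letters in `S` depends only on `y` and the first `N` letters
of `x`, so there are finitely many left quotients. -/
theorem isRegular_setOf_take_mem [Finite β] (N : ℕ) (S : Set (List β)) :
    IsRegular ({x | x.take N ∈ S} : Language β) := by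
  apply IsRegular.of_finite_range_leftQuotient
  refine ((List.finite_length_le β N).image
    (leftQuotient ({x | x.take N ∈ S} : Language β))).subset ?_
  rintro _ ⟨x, rfl⟩
  refine ⟨x.take N, by simp, ?_⟩
  refine Language.ext fun y => ?_
  change (x.take N ++ y).take N ∈ S ↔ (x ++ y).take N ∈ S
  rw [List.take_append, List.take_append, List.take_take, min_self]
  rcases le_total N x.length with h | h
  · rw [List.length_take, min_eq_left h, Nat.sub_eq_zero_of_le h, Nat.sub_self]
  · rw [List.take_of_length_le h]

theorem isRegular_of_finite [Finite β] {L : Language β} (hL : Set.Finite (L : Set (List β))) :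
    L.IsRegular := by
  obtain ⟨N, hN⟩ := (hL.image List.length).bddAbove
  have hlen : ∀ x ∈ L, x.length ≤ N := fun x hx => hN ⟨x, hx, rfl⟩
  suffices h : L = ({x | x.take (N + 1) ∈ L} : Language β) by
    rw [h]
    exact isRegular_setOf_take_mem (N + 1) (L : Set (List β))
  refine Language.ext fun x => ?_
  change x ∈ L ↔ x.take (N + 1) ∈ L
  by_cases h : x.length ≤ N + 1
  · rw [List.take_of_length_le h]
  · refine ⟨fun hx => absurd (hlen x hx) (by omega), fun hx => ?_⟩
    have := hlen _ hx
    rw [List.length_take] at this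
    omega

/-- A left quotient of `K * L` by `x` is determined by the quotient of `K` by `x` and by the set of
the quotients of `L` by the suffixes of `x` whose complementary prefix is in `K`. -/
theorem IsRegular.mul {K L : Language β} (hK : K.IsRegular) (hL : L.IsRegular) :
    (K * L).IsRegular := by
  apply IsRegular.of_finite_range_leftQuotient
  have hfin := (hK.finite_range_leftQuotient.prod
    hL.finite_range_leftQuotient.powerset).image
    (fun p : Language β × Set (Language β) => ({y | y ∈ p.1 * L ∨ ∃ M ∈ p.2, y ∈ M} : Language β))
  refine hfin.subset ?_
  rintro _ ⟨x, rfl⟩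
  refine ⟨(K.leftQuotient x, {M | ∃ u v, x = u ++ v ∧ u ∈ K ∧ M = L.leftQuotient v}),
    ⟨⟨x, rfl⟩, ?_⟩, ?_⟩
  · rintro M ⟨u, v, -, -, rfl⟩
    exact ⟨v, rfl⟩
  · refine Language.ext fun y => ?_
    change (y ∈ K.leftQuotient x * L ∨ _) ↔ x ++ y ∈ K * L
    rw [mem_mul, mem_mul]
    constructor
    · rintro (⟨a, ha, b, hb, rfl⟩ | ⟨M, ⟨u, v, rfl, hu, rfl⟩, hy⟩)
      · exact ⟨x ++ a, ha, b, hb, by simp⟩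
      · exact ⟨u, hu, v ++ y, hy, by simp⟩
    · rintro ⟨a, ha, b, hb, hab⟩
      rcases List.append_eq_append_iff.1 hab with ⟨c, rfl, rfl⟩ | ⟨c, rfl, rfl⟩
      · exact Or.inr ⟨_, ⟨a, c, rfl, ha, rfl⟩, hb⟩
      · exact Or.inl ⟨c, ha, b, hb, rfl⟩

theorem append_mem_kstar_iff {L : Language β} {x y : List β} :
    x ++ y ∈ KStar.kstar L ↔ (x = [] ∧ y ∈ KStar.kstar L) ∨
      ∃ u v, x = u ++ v ∧ u ∈ KStar.kstar L ∧ y ∈ L.leftQuotient v * KStar.kstar L := by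
  constructor
  · intro h
    obtain ⟨ws, hws, hL⟩ := mem_kstar.1 h
    clear h
    induction ws generalizing x with
    | nil =>
      obtain ⟨rfl, rfl⟩ := List.append_eq_nil_iff.1 hws
      exact Or.inl ⟨rfl, nil_mem_kstar L⟩
    | cons w ws ih =>
      have hw : w ∈ L := hL w (by simp)
      have hws' : ∀ y ∈ ws, y ∈ L := fun y hy => hL y (by simp [hy])
      rw [List.flatten_cons] at hws
      rcases List.append_eq_append_iff.1 hws with ⟨c, rfl, rfl⟩ | ⟨c, rfl, hc⟩
      · exact Or.inr ⟨[], x, rfl, nil_mem_kstar L,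
          mem_mul.2 ⟨c, hw, _, mem_kstar.2 ⟨ws, rfl, hws'⟩, rfl⟩⟩
      · rcases ih hc.symm hws' with ⟨rfl, hy⟩ | ⟨u, v, rfl, hu, hy⟩
        · refine Or.inr ⟨[], w, by simp, nil_mem_kstar L, mem_mul.2 ⟨[], ?_, y, hy, rfl⟩⟩
          simpa using hw
        · obtain ⟨us, rfl, hus⟩ := mem_kstar.1 hu
          refine Or.inr ⟨w ++ us.flatten, v, by simp, mem_kstar.2 ⟨w :: us, by simp, ?_⟩, hy⟩
          simpa using ⟨hw, hus⟩
  · rintro (⟨rfl, hy⟩ | ⟨u, v, rfl, hu, hy⟩)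
    · exact hy
    · obtain ⟨a, ha, b, hb, rfl⟩ := mem_mul.1 hy
      obtain ⟨us, rfl, hus⟩ := mem_kstar.1 hu
      obtain ⟨vs, rfl, hvs⟩ := mem_kstar.1 hb
      refine mem_kstar.2 ⟨us ++ [v ++ a] ++ vs, by simp, ?_⟩
      simp only [List.mem_append, List.mem_singleton]
      rintro w ((hw | rfl) | hw)
      exacts [hus w hw, ha, hvs w hw]

theorem IsRegular.kstar {L : Language β} (hL : L.IsRegular) : (KStar.kstar L).IsRegular := by
  apply IsRegular.of_finite_range_leftQuotient
  have hfin := ((Set.finite_univ (α := Prop)).prod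
    hL.finite_range_leftQuotient.powerset).image
    (fun p : Prop × Set (Language β) =>
      ({y | (p.1 ∧ y ∈ KStar.kstar L) ∨ ∃ M ∈ p.2, y ∈ M * KStar.kstar L} : Language β))
  refine hfin.subset ?_
  rintro _ ⟨x, rfl⟩
  refine ⟨(x = [], {M | ∃ u v, x = u ++ v ∧ u ∈ KStar.kstar L ∧ M = L.leftQuotient v}),
    ⟨trivial, ?_⟩, ?_⟩
  · rintro M ⟨u, v, -, -, rfl⟩
    exact ⟨v, rfl⟩
  · refine Language.ext fun y => Iff.trans ?_ append_mem_kstar_iff.symm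
    refine or_congr Iff.rfl ?_
    constructor
    · rintro ⟨M, ⟨u, v, h, hu, rfl⟩, hy⟩
      exact ⟨u, v, h, hu, hy⟩
    · rintro ⟨u, v, h, hu, hy⟩
      exact ⟨_, ⟨u, v, h, hu, rfl⟩, hy⟩

end Language

namespace StringConstraints

theorem reduceOption_map_some {β : Type} (l : List β) : (l.map some).reduceOption = l := by
  simp [List.reduceOption]

/-! ### Automata presented as finite data -/

theorem FSA.mem_language_iff {β : Type} (A : FSA β) (u : List β) :
    u ∈ A.language ↔ ∃ s ∈ A.initial, ∃ t ∈ A.accepting, ∃ x : List (Option β),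
      x.reduceOption = u ∧ A.toεNFA.IsPath s t x := by
  rw [FSA.language, εNFA.mem_accepts_iff_exists_path]
  constructor
  · rintro ⟨s, t, x, hs, ht, hx, hp⟩
    exact ⟨s, hs, t, ht, x, hx, hp⟩
  · rintro ⟨s, hs, t, ht, x, hx, hp⟩
    exact ⟨s, t, x, hs, ht, hx, hp⟩

theorem exists_fsa_language_eq {β : Type} [Finite β] {L : Language β} (hL : L.IsRegular) :
    ∃ A : FSA β, A.language = L := by
  classical
  obtain ⟨σ, _, M, rfl⟩ := hL
  have := Fintype.ofFinite β
  let e : σ → ℕ := fun s => Fintype.equivFin σ s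
  have he : Function.Injective e := Fin.val_injective.comp (Fintype.equivFin σ).injective
  let A : FSA β :=
    { transitions := (Finset.univ : Finset (σ × β)).toList.map
        fun p => (e p.1, some p.2, e (M.step p.1 p.2))
      initial := [e M.start]
      accepting := (Finset.univ.filter (· ∈ M.accept)).toList.map e }
  have hstep : ∀ s t a, t ∈ A.toεNFA.step s a ↔
      ∃ p b, s = e p ∧ a = some b ∧ t = e (M.step p b) := by
    intro s t a
    change (s, a, t) ∈ A.transitions ↔ _
    simp only [A, List.mem_map, Finset.mem_toList, Finset.mem_univ, true_and, Prod.exists,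
      Prod.mk.injEq]
    constructor <;> rintro ⟨p, b, rfl, rfl, rfl⟩ <;> exact ⟨p, b, rfl, rfl, rfl⟩
  have hpath : ∀ s t x, A.toεNFA.IsPath s t x → ∀ p, s = e p →
      t = e (M.evalFrom p x.reduceOption) := by
    intro s t x h
    induction h with
    | nil s => intro p hp; simpa using hp
    | cons t s u a x ht _ ih =>
      rintro p rfl
      obtain ⟨q, b, hq, rfl, rfl⟩ := (hstep _ _ _).1 ht
      obtain rfl := he hq
      rw [ih _ rfl]
      simp [DFA.evalFrom]
  have hpath' : ∀ (u : List β) p, A.toεNFA.IsPath (e p) (e (M.evalFrom p u)) (u.map some) := by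
    intro u
    induction u with
    | nil => intro p; exact .nil _
    | cons b u ih =>
      intro p
      exact .cons (e (M.step p b)) _ _ _ _ ((hstep _ _ _).2 ⟨p, b, rfl, rfl, rfl⟩) (ih _)
  refine ⟨A, ?_⟩
  ext u
  rw [FSA.mem_language_iff, DFA.mem_accepts]
  constructor
  · rintro ⟨s, hs, t, ht, x, rfl, hx⟩
    have hs' : s = e M.start := by simpa [A] using hs
    have := hpath _ _ _ hx _ hs'
    obtain ⟨q, hq, rfl⟩ : ∃ q, q ∈ M.accept ∧ e q = t := by simpa [A] using ht
    rw [he this] at hq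
    exact hq
  · intro hu
    refine ⟨e M.start, by simp [A], e (M.eval u), ?_, u.map some, reduceOption_map_some _,
      hpath' _ _⟩
    simpa [A] using ⟨_, hu, rfl⟩

/-- The automaton with states `0, …, |w|` that accepts exactly the word `w`. -/
def FSA.word {β : Type} (w : List β) : FSA β where
  transitions := (List.range w.length).map fun i => (i, w[i]?, i + 1)
  initial := [0]
  accepting := [w.length]

theorem FSA.mem_language_word {β : Type} (w u : List β) :
    u ∈ (FSA.word w).language ↔ u = w := by
  have hstep : ∀ s t a, t ∈ (FSA.word w).toεNFA.step s a ↔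
      s < w.length ∧ a = w[s]? ∧ t = s + 1 := by
    intro s t a
    change (s, a, t) ∈ (FSA.word w).transitions ↔ _
    simp only [FSA.word, List.mem_map, List.mem_range, Prod.mk.injEq]
    constructor
    · rintro ⟨i, hi, rfl, rfl, rfl⟩
      exact ⟨hi, rfl, rfl⟩
    · rintro ⟨hi, rfl, rfl⟩
      exact ⟨s, hi, rfl, rfl, rfl⟩
  rw [FSA.mem_language_iff]
  constructor
  · rintro ⟨s, hs, t, ht, x, rfl, hx⟩
    obtain rfl : s = 0 := by simpa [FSA.word] using hs
    obtain rfl : t = w.length := by simpa [FSA.word] using ht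
    have key : ∀ s t x, (FSA.word w).toεNFA.IsPath s t x →
        x.reduceOption ++ w.drop t = w.drop s := by
      intro s t x h
      induction h with
      | nil s => simp
      | cons t s u a x ht _ ih =>
        obtain ⟨hs, rfl, rfl⟩ := (hstep _ _ _).1 ht
        rw [List.getElem?_eq_getElem hs, List.reduceOption_cons_of_some, List.cons_append, ih,
          List.getElem_cons_drop]
    simpa using key _ _ _ hx
  · rintro rfl
    refine ⟨0, by simp [FSA.word], u.length, by simp [FSA.word], u.map some,
      reduceOption_map_some _, ?_⟩
    have key : ∀ k s, s + k = u.length →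
        (FSA.word u).toεNFA.IsPath s u.length ((u.drop s).map some) := by
      intro k
      induction k with
      | zero =>
        intro s hs
        obtain rfl : s = u.length := by omega
        simp
      | succ k ih =>
        intro s hs
        have hs' : s < u.length := by omega
        rw [List.drop_eq_getElem_cons hs', List.map_cons]
        exact .cons (s + 1) _ _ _ _
          ((hstep _ _ _).2 ⟨hs', (List.getElem?_eq_getElem hs').symm, rfl⟩) (ih _ (by omega))
    simpa using key u.length 0 (by simp)

/-! ### Rational relations -/

variable {α : Type}

/-- A binary relation on words is rational if it is spelled by a regular language over the alphabet
`(α ∪ {ε}) × (α ∪ {ε})`. -/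
def IsRational (R : List α → List α → Prop) : Prop :=
  ∃ L : Language (Option α × Option α), L.IsRegular ∧
    ∀ p q, R p q ↔ ∃ u ∈ L, p = (u.map Prod.fst).reduceOption ∧ q = (u.map Prod.snd).reduceOption

theorem IsRational.exists_transducer [Finite α] {R : List α → List α → Prop} (hR : IsRational R) :
    ∃ T : Transducer α, ∀ p q, (p, q) ∈ T.relation ↔ R p q := by
  obtain ⟨L, hL, h⟩ := hR
  obtain ⟨A, rfl⟩ := exists_fsa_language_eq hL
  exact ⟨A, fun p q => (h p q).symm⟩

/-- Componentwise concatenation of two relations on words. -/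
def RelMul (R S : List α → List α → Prop) (p q : List α) : Prop :=
  ∃ p₁ p₂ q₁ q₂, R p₁ q₁ ∧ S p₂ q₂ ∧ p = p₁ ++ p₂ ∧ q = q₁ ++ q₂

/-- The Kleene star of a relation on words with respect to componentwise concatenation. -/
inductive RelStar (R : List α → List α → Prop) : List α → List α → Prop
  | nil : RelStar R [] []
  | append {p q p' q' : List α} : R p q → RelStar R p' q' → RelStar R (p ++ p') (q ++ q')

theorem IsRational.mul {R S : List α → List α → Prop} (hR : IsRational R) (hS : IsRational S) :
    IsRational (RelMul R S) := by
  obtain ⟨K, hK, hKR⟩ := hR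
  obtain ⟨L, hL, hLS⟩ := hS
  refine ⟨K * L, hK.mul hL, fun p q => ?_⟩
  constructor
  · rintro ⟨p₁, p₂, q₁, q₂, h₁, h₂, rfl, rfl⟩
    obtain ⟨u, hu, rfl, rfl⟩ := (hKR _ _).1 h₁
    obtain ⟨v, hv, rfl, rfl⟩ := (hLS _ _).1 h₂
    exact ⟨u ++ v, Language.mem_mul.2 ⟨u, hu, v, hv, rfl⟩, by simp [List.reduceOption_append],
      by simp [List.reduceOption_append]⟩
  · rintro ⟨w, hw, rfl, rfl⟩
    obtain ⟨u, hu, v, hv, rfl⟩ := Language.mem_mul.1 hw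
    exact ⟨_, _, _, _, (hKR _ _).2 ⟨u, hu, rfl, rfl⟩, (hLS _ _).2 ⟨v, hv, rfl, rfl⟩,
      by simp [List.reduceOption_append], by simp [List.reduceOption_append]⟩

theorem IsRational.star {R : List α → List α → Prop} (hR : IsRational R) :
    IsRational (RelStar R) := by
  obtain ⟨K, hK, hKR⟩ := hR
  refine ⟨KStar.kstar K, hK.kstar, fun p q => ?_⟩
  constructor
  · intro h
    induction h with
    | nil => exact ⟨[], Language.nil_mem_kstar K, rfl, rfl⟩
    | append h _ ih =>
      obtain ⟨u, hu, rfl, rfl⟩ := (hKR _ _).1 h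
      obtain ⟨v, hv, rfl, rfl⟩ := ih
      obtain ⟨vs, rfl, hvs⟩ := Language.mem_kstar.1 hv
      refine ⟨u ++ vs.flatten, Language.mem_kstar.2 ⟨u :: vs, by simp, ?_⟩,
        by simp [List.reduceOption_append], by simp [List.reduceOption_append]⟩
      simpa using ⟨hu, hvs⟩
  · rintro ⟨w, hw, rfl, rfl⟩
    obtain ⟨ws, rfl, hws⟩ := Language.mem_kstar.1 hw
    clear hw
    induction ws with
    | nil => exact .nil
    | cons u ws ih =>
      rw [List.flatten_cons, List.map_append, List.map_append, List.reduceOption_append,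
        List.reduceOption_append]
      exact .append ((hKR _ _).2 ⟨u, hws u (by simp), rfl, rfl⟩)
        (ih fun y hy => hws y (by simp [hy]))

/-- A finite family of pairs of words is a rational relation. -/
theorem isRational_finite [Finite α] {ι : Type} [Finite ι] (f g : ι → List α) :
    IsRational fun p q => ∃ i, p = f i ∧ q = g i := by
  let w : ι → List (Option α × Option α) := fun i =>
    (f i).map (fun a => (some a, none)) ++ (g i).map (fun a => (none, some a))
  have h₁ : ∀ i, ((w i).map Prod.fst).reduceOption = f i := by
    intro i
    simp [w, Function.comp_def, List.reduceOption_append, reduceOption_map_some]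
  have h₂ : ∀ i, ((w i).map Prod.snd).reduceOption = g i := by
    intro i
    simp [w, Function.comp_def, List.reduceOption_append, reduceOption_map_some]
  refine ⟨(Set.range w : Set _), Language.isRegular_of_finite (Set.finite_range w), fun p q => ?_⟩
  constructor
  · rintro ⟨i, rfl, rfl⟩
    exact ⟨w i, ⟨i, rfl⟩, (h₁ i).symm, (h₂ i).symm⟩
  · rintro ⟨_, ⟨i, rfl⟩, rfl, rfl⟩
    exact ⟨i, h₁ i, h₂ i⟩

theorem IsRational.of_iff {R S : List α → List α → Prop} (hR : IsRational R)
    (h : ∀ p q, S p q ↔ R p q) : IsRational S := by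
  have : S = R := by ext p q; exact h p q
  rwa [this]

theorem isRational_length_eq [Finite α] :
    IsRational fun p q : List α => p.length = q.length := by
  refine ((isRational_finite (fun i : α × α => [i.1]) (fun i => [i.2])).star).of_iff
    fun p q => ⟨fun h => ?_, fun h => ?_⟩
  · induction p generalizing q with
    | nil =>
      obtain rfl : q = [] := List.length_eq_zero_iff.1 h.symm
      exact .nil
    | cons a p ih =>
      cases q with
      | nil => simp at h
      | cons b q => exact .append ⟨(a, b), rfl, rfl⟩ (ih q (by simpa using h))
  · induction h with
    | nil => rfl
    | append h _ ih =>
      obtain ⟨i, rfl, rfl⟩ := h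
      simpa using ih

theorem isRational_nil_right [Finite α] :
    IsRational fun _ q : List α => q = [] := by
  refine ((isRational_finite (fun i : α => [i]) (fun _ => [])).star).of_iff
    fun p q => ⟨fun h => ?_, fun h => ?_⟩
  · subst h
    induction p with
    | nil => exact .nil
    | cons a p ih => exact .append (p := [a]) (q := []) ⟨a, rfl, rfl⟩ ih
  · induction h with
    | nil => rfl
    | append h _ ih =>
      obtain ⟨i, rfl, rfl⟩ := h
      simpa using ih

theorem isRational_nil_left [Finite α] :
    IsRational fun p _ : List α => p = [] := by
  refine ((isRational_finite (fun _ => []) (fun i : α => [i])).star).of_iff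
    fun p q => ⟨fun h => ?_, fun h => ?_⟩
  · subst h
    induction q with
    | nil => exact .nil
    | cons a q ih => exact .append (p := []) (q := [a]) ⟨a, rfl, rfl⟩ ih
  · induction h with
    | nil => rfl
    | append h _ ih =>
      obtain ⟨i, rfl, rfl⟩ := h
      simpa using ih

theorem isRational_length_lt [Finite α] :
    IsRational fun p q : List α => q.length < p.length := by
  refine ((isRational_length_eq (α := α)).mul
    ((isRational_finite (fun i : α => [i]) (fun _ => [])).mul isRational_nil_right)).of_iff
    fun p q => ⟨fun h => ?_, fun h => ?_⟩
  · refine ⟨p.take q.length, p.drop q.length, q, [], by simpa using h.le,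
      ⟨[p[q.length]], p.drop (q.length + 1), [], [], ⟨_, rfl, rfl⟩, rfl, ?_, rfl⟩,
      (List.take_append_drop _ _).symm, by simp⟩
    simp
  · obtain ⟨p₁, p₂, q₁, q₂, h₁, ⟨p₃, p₄, q₃, q₄, ⟨i, rfl, rfl⟩, rfl, rfl, rfl⟩, rfl, rfl⟩ := h
    simp [← h₁]

theorem isRational_eq_of_mem_range [Finite α] {Γ : Type} [Finite Γ] (f : Γ → α) :
    IsRational fun p q : List α => ∃ l : List Γ, p = l.map f ∧ q = l.map f := by
  refine ((isRational_finite (fun i => [f i]) (fun i => [f i])).star).of_iff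
    fun p q => ⟨?_, fun h => ?_⟩
  · rintro ⟨l, rfl, rfl⟩
    induction l with
    | nil => exact .nil
    | cons a l ih => exact .append (p := [f a]) (q := [f a]) ⟨a, rfl, rfl⟩ ih
  · induction h with
    | nil => exact ⟨[], rfl, rfl⟩
    | append h _ ih =>
      obtain ⟨i, rfl, rfl⟩ := h
      obtain ⟨l, rfl, rfl⟩ := ih
      exact ⟨i :: l, rfl, rfl⟩

theorem isRational_prefix [Finite α] : IsRational fun p q : List α => p <+: q := by
  refine ((isRational_eq_of_mem_range (id : α → α)).mul isRational_nil_left).of_iff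
    fun p q => ⟨?_, ?_⟩
  · rintro ⟨t, rfl⟩
    exact ⟨p, [], p, t, ⟨p, by simp⟩, rfl, by simp, rfl⟩
  · rintro ⟨p₁, p₂, q₁, q₂, ⟨l, rfl, rfl⟩, rfl, rfl, rfl⟩
    simp

end StringConstraints

/-! ### A universal Turing machine -/

open Turing

theorem Nat.bits_eq (n : ℕ) :
    n.bits = if n = 0 then [] else n.bodd :: n.div2.bits := by
  split_ifs with h
  · simp [h]
  · conv_lhs => rw [← Nat.bit_bodd_div2 n]
    apply Nat.bits_append_bit
    intro h0
    rw [← Bool.not_eq_false]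
    intro h1
    exact h (by rw [← Nat.bit_bodd_div2 n, h0, h1]; rfl)

theorem Primrec.nat_bits : Primrec Nat.bits := by
  have hg : Primrec₂ fun (_ : Unit) (l : List (List Bool)) =>
      some (if l.length = 0 then [] else l.length.bodd :: l.getD l.length.div2 []) := by
    have hl : Primrec fun p : Unit × List (List Bool) => p.2.length :=
      Primrec.list_length.comp Primrec.snd
    exact Primrec.option_some.comp (Primrec.ite (Primrec.eq.comp hl (Primrec.const 0))
      (Primrec.const [])
      (Primrec.list_cons.comp (Primrec.nat_bodd.comp hl)
        ((Primrec.list_getD []).comp Primrec.snd (Primrec.nat_div2.comp hl))))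
  have := Primrec.nat_strong_rec (fun (_ : Unit) n => Nat.bits n) hg ?_
  · exact this.comp (Primrec.const ()) Primrec.id
  · rintro _ n
    simp only [List.length_map, List.length_range, Option.some.injEq]
    rw [Nat.bits_eq n]
    split_ifs with h
    · rfl
    · have hlt : n.div2 < n := by
        rw [Nat.div2_val]; omega
      simp [List.getD_eq_getElem?_getD, hlt]

/-- The letter that stands for a binary digit on the stacks of the machine `PartrecToTM2.tr`. -/
def bitLetter (b : Bool) : PartrecToTM2.Γ' :=
  bif b then PartrecToTM2.Γ'.bit1 else PartrecToTM2.Γ'.bit0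

theorem trNat_eq_map_bits (n : ℕ) : PartrecToTM2.trNat n = n.bits.map bitLetter := by
  have h : ∀ p : PosNum, PartrecToTM2.trPosNum p = (p : ℕ).bits.map bitLetter := by
    intro p
    induction p with
    | one => simp [PartrecToTM2.trPosNum, bitLetter]
    | bit1 p ih =>
      have : ((p.bit1 : PosNum) : ℕ) = 2 * (p : ℕ) + 1 := by
        rw [PosNum.cast_bit1]; ring
      rw [this, Nat.bit1_bits]
      simp [PartrecToTM2.trPosNum, ih, bitLetter]
    | bit0 p ih =>
      have : ((p.bit0 : PosNum) : ℕ) = 2 * (p : ℕ) := by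
        rw [PosNum.cast_bit0]; ring
      rw [this, Nat.bit0_bits _ (PosNum.cast_pos p).ne']
      simp [PartrecToTM2.trPosNum, ih, bitLetter]
  have h' : ∀ p : Num, PartrecToTM2.trNum p = (p : ℕ).bits.map bitLetter := by
    intro p
    cases p with
    | zero => simp [PartrecToTM2.trNum]
    | pos p => exact h p
  rw [PartrecToTM2.trNat, h', Num.to_of_nat]

/-- A machine with a finite support can be restricted to it. -/
theorem exists_finite_turingMachine {Γ Λ : Type} [Inhabited Γ] [Inhabited Λ] (M : TM0.Machine Γ Λ)
    {S : Set Λ} (hS : S.Finite) (ss : TM0.Supports M S) :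
    ∃ (Q : Type) (_ : Finite Q) (_ : Inhabited Q) (M' : TM0.Machine Γ Q),
      ∀ l, (TM0.eval M' l).Dom ↔ (TM0.eval M l).Dom := by
  classical
  let i₀ : Inhabited S := ⟨⟨default, ss.1⟩⟩
  let g₁ : PointedMap Λ S := ⟨fun q => if h : q ∈ S then ⟨q, h⟩ else default, by
    rw [dif_pos ss.1]; rfl⟩
  let f : PointedMap Γ Γ := ⟨id, rfl⟩
  refine ⟨S, hS.to_subtype, i₀, M.map f f g₁ Subtype.val, fun l => ?_⟩
  have hresp := TM0.Machine.map_respects M f f g₁ Subtype.val ss (fun _ => rfl)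
    (fun q hq => by
      change ((if h : q ∈ S then (⟨q, h⟩ : S) else default : S) : Λ) = q
      rw [dif_pos hq])
  refine StateTransition.tr_eval_dom hresp ⟨ss.1, ?_⟩
  rw [TM0.map_init]
  change TM0.init (l.map id) = TM0.init l
  rw [List.map_id]

/-- There is a finite Turing machine whose halting problem is undecidable already for inputs that
are the binary expansion of a number, preceded by a fixed letter. -/
theorem exists_turingMachine_halting_undecidable :
    ∃ (Γ Q : Type) (_ : Finite Γ) (_ : Finite Q) (_ : Inhabited Γ) (_ : Inhabited Q)
      (M : TM0.Machine Γ Q) (a : Γ) (g : Bool → Γ),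
      ¬ ComputablePred fun k : ℕ => (TM0.eval M (a :: (k.bits.reverse.map g))).Dom := by
  obtain ⟨C, hC⟩ : ∃ C : ToPartrec.Code, ∀ k : ℕ, (C.eval [k]).Dom ↔
      (Nat.Partrec.Code.eval (Denumerable.ofNat Nat.Partrec.Code k) 0).Dom := by
    have hp : Partrec fun k : ℕ =>
        Nat.Partrec.Code.eval (Denumerable.ofNat Nat.Partrec.Code k) 0 :=
      Nat.Partrec.Code.eval_part.comp (Computable.ofNat _) (Computable.const 0)
    obtain ⟨C, hC⟩ := ToPartrec.Code.exists_code (Nat.Partrec'.part_iff₁.2 hp)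
    refine ⟨C, fun k => ?_⟩
    have := hC ⟨[k], rfl⟩
    change C.eval [k] = _ at this
    rw [this]
    rfl
  let : Inhabited PartrecToTM2.Λ' := ⟨PartrecToTM2.trNormal C PartrecToTM2.Cont'.halt⟩
  let M₁ := TM2to1.tr (K := PartrecToTM2.K') PartrecToTM2.tr
  obtain ⟨Q, hQ, iQ, M, hM⟩ := exists_finite_turingMachine _ (Finset.finite_toSet _)
    (TM1to0.tr_supports M₁
      (TM2to1.tr_supports _ (PartrecToTM2.tr_supports C PartrecToTM2.Cont'.halt)))
  let letter : Bool → PartrecToTM2.Γ' → TM2to1.Γ' PartrecToTM2.K' fun _ => PartrecToTM2.Γ' :=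
    fun b c => (b, Function.update (fun _ => none) PartrecToTM2.K'.main (some c))
  have hstk : Finite PartrecToTM2.K' :=
    Finite.of_surjective (![.main, .rev, .aux, .stack] : Fin 4 → PartrecToTM2.K') (by
      rintro (_ | _ | _ | _)
      exacts [⟨0, rfl⟩, ⟨1, rfl⟩, ⟨2, rfl⟩, ⟨3, rfl⟩])
  have hfin : Finite (TM2to1.Γ' PartrecToTM2.K' fun _ => PartrecToTM2.Γ') :=
    inferInstanceAs (Finite (Bool × (PartrecToTM2.K' → Option PartrecToTM2.Γ')))
  refine ⟨_, Q, hfin, hQ, inferInstance, iQ, M, letter true PartrecToTM2.Γ'.cons,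
    fun b => letter false (bitLetter b), fun hdec => ?_⟩
  have key : ∀ k : ℕ, (TM0.eval M (letter true PartrecToTM2.Γ'.cons ::
      k.bits.reverse.map fun b => letter false (bitLetter b))).Dom ↔
      (Nat.Partrec.Code.eval (Denumerable.ofNat Nat.Partrec.Code k) 0).Dom := by
    intro k
    have hrev : (PartrecToTM2.trList [k]).reverse =
        PartrecToTM2.Γ'.cons :: k.bits.reverse.map bitLetter := by
      simp [trNat_eq_map_bits]
    have hinit : TM2to1.trInit PartrecToTM2.K'.main (PartrecToTM2.trList [k]) =
        letter true PartrecToTM2.Γ'.cons ::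
          k.bits.reverse.map fun b => letter false (bitLetter b) := by
      rw [TM2to1.trInit, hrev]
      change letter true PartrecToTM2.Γ'.cons ::
        (k.bits.reverse.map bitLetter).map (letter false) = _
      rw [List.map_map]
      rfl
    rw [← hinit, hM, TM1to0.tr_eval, ← hC k]
    refine (TM2to1.tr_eval_dom PartrecToTM2.tr _ _).trans ?_
    have hstart : (TM2.init PartrecToTM2.K'.main (PartrecToTM2.trList [k]) :
        TM2.Cfg (fun _ : PartrecToTM2.K' => PartrecToTM2.Γ') PartrecToTM2.Λ'
          (Option PartrecToTM2.Γ')) = PartrecToTM2.init C [k] := by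
      change TM2.Cfg.mk _ _ _ = TM2.Cfg.mk _ _ _
      congr 1
      funext i
      cases i <;> rfl
    change (StateTransition.eval _ (TM2.init _ _)).Dom ↔ _
    rw [hstart]
    erw [PartrecToTM2.tr_eval]
    rfl
  refine ComputablePred.halting_problem 0 ?_
  obtain ⟨f, hf, hfk⟩ := ComputablePred.computable_iff.1 hdec
  refine ComputablePred.computable_iff.2 ⟨fun c => f (Encodable.encode c),
    hf.comp Computable.encode, funext fun c => ?_⟩
  rw [← congrFun hfk, key, Denumerable.ofNat_encode]

namespace StringConstraints

/-! ### Sets of tuples that are determined by prefixes of bounded length -/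

theorem isREG_of_forall_take_eq {α : Type} [Finite α] {n : ℕ} (N : ℕ)
    (S : Set (Fin n → List α)) : IsREG {u | (fun j => (u j).take N) ∈ S} := by
  let F : Set (Fin n → List α) := {w | w ∈ S ∧ ∀ j, (w j).length ≤ N}
  have hF : F.Finite := (Set.Finite.pi' fun _ : Fin n => List.finite_length_le α N).subset
    fun w hw => hw.2
  have := hF.fintype
  let e := Fintype.equivFin F
  refine ⟨Fintype.card F, fun i j => {x | x.take N ∈ ({(e.symm i).1 j} : Set (List α))},
    fun i j => Language.isRegular_setOf_take_mem N _, ?_⟩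
  ext u
  constructor
  · intro hu
    refine ⟨e ⟨fun j => (u j).take N, hu, fun j => by simp⟩, fun j => ?_⟩
    change (u j).take N = ((e.symm (e _)).1 j)
    rw [Equiv.symm_apply_apply]
  · rintro ⟨i, hi⟩
    have : (fun j => (u j).take N) = (e.symm i).1 := funext hi
    change (fun j => (u j).take N) ∈ S
    rw [this]
    exact (e.symm i).2.1

/-! ### Histories of a deterministic system -/

section History

variable {C α : Type} (step : C → Option C) (enc : C → List α) (h : α)

/-- The successor configuration; a configuration without successor is repeated. -/
def advance (c : C) : C := (step c).getD c

/-- The first `n` configurations of the run from a given configuration, written as words and each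
followed by the separator `h`. -/
def history : ℕ → C → List α
  | 0, _ => []
  | n + 1, c => (enc c ++ [h]) ++ history n (advance step c)

/-- The relation between a configuration and its successor, both followed by the separator. -/
def BlockStep (p q : List α) : Prop :=
  ∃ c c', step c = some c' ∧ p = enc c ++ [h] ∧ q = enc c' ++ [h]

theorem history_succ (n : ℕ) (c : C) : history step enc h (n + 1) c =
    history step enc h n c ++ (enc ((advance step)^[n] c) ++ [h]) := by
  induction n generalizing c with
  | zero => simp [history]
  | succ n ih =>
    rw [history, ih, history, Function.iterate_succ_apply]
    simp only [List.append_assoc]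

theorem length_history_strictMono (c : C) :
    StrictMono fun n => (history step enc h n c).length := by
  refine strictMono_nat_of_lt_succ fun n => ?_
  rw [history_succ]
  simp

theorem relStar_history (n : ℕ) (c : C) (hc : ∀ j < n, step ((advance step)^[j] c) ≠ none) :
    RelStar (BlockStep step enc h) (history step enc h n c)
      (history step enc h n (advance step c)) := by
  induction n generalizing c with
  | zero => exact .nil
  | succ n ih =>
    obtain ⟨c', hc'⟩ := Option.ne_none_iff_exists'.1 (hc 0 (Nat.succ_pos n))
    rw [Function.iterate_zero_apply] at hc'
    refine .append ⟨c, advance step c, by simp [advance, hc'], rfl, rfl⟩ (ih _ fun j hj => ?_)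
    rw [← Function.iterate_succ_apply]
    exact hc (j + 1) (Nat.succ_lt_succ hj)

/-- A word is uniquely split at its first letter with a given property. -/
theorem append_cons_inj {P : α → Prop} {u v s t : List α} {x y : α} (hu : ∀ a ∈ u, ¬ P a)
    (hv : ∀ a ∈ v, ¬ P a) (hx : P x) (hy : P y) (he : u ++ x :: s = v ++ y :: t) :
    u = v ∧ x = y ∧ s = t := by
  induction u generalizing v with
  | nil =>
    cases v with
    | nil => simpa using he
    | cons b v => exact absurd ((List.cons.inj he).1 ▸ hx) (hv b (by simp))
  | cons a u ih =>
    cases v with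
    | nil => exact absurd ((List.cons.inj he).1 ▸ hy) (hu a (by simp))
    | cons b v =>
      obtain ⟨rfl, he'⟩ := List.cons.inj he
      obtain ⟨rfl, h⟩ := ih (fun a ha => hu a (List.mem_cons_of_mem _ ha))
        (fun a ha => hv a (List.mem_cons_of_mem _ ha)) he'
      exact ⟨rfl, h⟩

variable {step enc h}

/-- The separators allow to parse a word uniquely into configurations. Hence if the first component
of a pair in the star of the step relation starts with a piece of a run, then the second one starts
with the same piece shifted by one step, and no configuration in this piece is final. -/
theorem RelStar.history_prefix (henc : Function.Injective enc) (hh : ∀ c, h ∉ enc c)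
    {p q : List α} (hpq : RelStar (BlockStep step enc h) p q) (n : ℕ) (c : C)
    (hp : history step enc h n c <+: p) :
    history step enc h n (advance step c) <+: q ∧
      ∀ j < n, step ((advance step)^[j] c) ≠ none := by
  induction hpq generalizing n c with
  | nil =>
    cases n with
    | zero => simp [history]
    | succ n => simp [history] at hp
  | append hstep _ ih =>
    cases n with
    | zero => simp [history]
    | succ n =>
      obtain ⟨d, d', hd, rfl, rfl⟩ := hstep
      obtain ⟨t, ht⟩ := hp
      simp only [history, List.append_assoc, List.singleton_append] at ht
      obtain ⟨h₁, -, h₂⟩ := append_cons_inj (P := (· = h)) (fun a ha hah => hh c (hah ▸ ha))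
        (fun a ha hah => hh d (hah ▸ ha)) rfl rfl ht
      obtain rfl := henc h₁
      obtain ⟨h₃, h₄⟩ := ih n _ ⟨t, h₂⟩
      have hadv : advance step c = d' := by simp [advance, hd]
      refine ⟨?_, fun j hj => ?_⟩
      · rw [history, hadv]
        rw [hadv] at h₃
        exact (List.prefix_append_right_inj _).2 h₃
      · cases j with
        | zero => simp [hd]
        | succ j =>
          rw [Function.iterate_succ_apply]
          exact h₄ j (by omega)

theorem eval_dom_iff_exists_step_eq_none (c : C) :
    (StateTransition.eval step c).Dom ↔ ∃ n, step ((advance step)^[n] c) = none := by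
  have hreach : ∀ b, StateTransition.Reaches step c b → ∃ n, (advance step)^[n] c = b := by
    intro b hb
    induction hb with
    | refl => exact ⟨0, rfl⟩
    | tail _ hbc ih =>
      obtain ⟨n, rfl⟩ := ih
      refine ⟨n + 1, ?_⟩
      rw [Function.iterate_succ_apply', advance, Option.mem_def.1 hbc, Option.getD_some]
  have hreach' : ∀ n, StateTransition.Reaches step c ((advance step)^[n] c) := by
    intro n
    induction n with
    | zero => exact .refl
    | succ n ih =>
      rw [Function.iterate_succ_apply']
      cases hs : step ((advance step)^[n] c) with
      | none => simpa [advance, hs] using ih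
      | some b => exact ih.tail (by simp [advance, hs])
  rw [Part.dom_iff_mem]
  constructor
  · rintro ⟨b, hb⟩
    obtain ⟨hb, hb'⟩ := StateTransition.mem_eval.1 hb
    obtain ⟨n, rfl⟩ := hreach b hb
    exact ⟨n, hb'⟩
  · rintro ⟨n, hn⟩
    exact ⟨_, StateTransition.mem_eval.2 ⟨hreach' n, hn⟩⟩

end History

/-! ### The two constraints -/

section Constraints

variable {α : Type}

/-- The constraint `(z, x) ∈ R(T₁) ∧ (x, y) ∈ R(T₂)`. The variables `z, x, v, y` have the
numbers `0, 1, 2, 3`. -/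
def runConstraint (T₁ T₂ : Transducer α) : Constraint α 4 :=
  [.related [0] [1] T₁, .related [1] [3] T₂]

/-- The constraint `v = w ∧ (z, x) ∈ R(T₁) ∧ (x, v y) ∈ R(T₂)`. -/
def shiftConstraint (T₁ T₂ : Transducer α) (w : List α) : Constraint α 4 :=
  [.member 2 (FSA.word w), .related [0] [1] T₁, .related [1] [2, 3] T₂]

theorem runConstraint_isStraightLine (T₁ T₂ : Transducer α) :
    (runConstraint T₁ T₂).IsStraightLine := by
  refine ⟨Equiv.refl _, 2, by omega, [], ![[1], [3]], ![T₁, T₂], ?_, ?_⟩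
  · simp [runConstraint, List.ofFn_succ]
  · intro i j
    fin_cases i <;> simp +contextual

theorem shiftConstraint_isStraightLine (T₁ T₂ : Transducer α) (w : List α) :
    (shiftConstraint T₁ T₂ w).IsStraightLine := by
  refine ⟨Equiv.refl _, 2, by omega, [(2, FSA.word w)], ![[1], [2, 3]], ![T₁, T₂], ?_, ?_⟩
  · simp [shiftConstraint, List.ofFn_succ]
  · intro i j
    fin_cases i
    · simp +contextual
    · simp only [Equiv.refl_apply]
      rintro h
      have : j = 2 ∨ j = 3 := by simpa using h
      rcases this with rfl | rfl <;> simp [Fin.lt_def]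

theorem mem_language_runConstraint {T₁ T₂ : Transducer α} {η : Fin 4 → List α} :
    η ∈ (runConstraint T₁ T₂).language ↔
      (η 0, η 1) ∈ T₁.relation ∧ (η 1, η 3) ∈ T₂.relation := by
  simp [runConstraint, Constraint.language, Atomic.Holds, Term.eval]

theorem mem_language_shiftConstraint {T₁ T₂ : Transducer α} {w : List α}
    {η : Fin 4 → List α} :
    η ∈ (shiftConstraint T₁ T₂ w).language ↔
      η 2 = w ∧ (η 0, η 1) ∈ T₁.relation ∧ (η 1, η 2 ++ η 3) ∈ T₂.relation := by
  simp [shiftConstraint, Constraint.language, Atomic.Holds, Term.eval, FSA.mem_language_word]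

end Constraints

section Separability

variable {C α : Type} {step : C → Option C} {enc : C → List α} {h : α}
  {Teq Tstep Tlt Tpre : Transducer α}

/-- If the run is infinite, its histories yield solutions of the first constraint. Replacing `z` by
the word for a longer history gives solutions of the second one, and by the pigeonhole principle a
finite union of products cannot tell all of them apart. -/
theorem not_REGSeparable_of_infinite
    (hTeq : ∀ p q, (p, q) ∈ Teq.relation ↔ p.length = q.length)
    (hTlt : ∀ p q, (p, q) ∈ Tlt.relation ↔ q.length < p.length)
    (hTpre : ∀ p q, (p, q) ∈ Tpre.relation ↔ p <+: q)
    (hTstep : ∀ p q, (p, q) ∈ Tstep.relation ↔ RelStar (BlockStep step enc h) p q)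
    (c : C) (hc : ∀ n, step ((advance step)^[n] c) ≠ none) :
    ¬ REGSeparable (runConstraint Teq Tstep) (shiftConstraint Tlt Tpre (enc c ++ [h])) := by
  rintro ⟨R, ⟨k, L, -, rfl⟩, hsub, hdisj⟩
  let X : ℕ → List α := fun n => history step enc h n c
  let Y : ℕ → List α := fun n => history step enc h n (advance step c)
  let Z : ℕ → List α := fun n => List.replicate (X n).length h
  obtain ⟨n, m, hnm, hZ⟩ : ∃ n m, n < m ∧
      {i : Fin k | Z n ∈ L i 0} = {i : Fin k | Z m ∈ L i 0} := by
    obtain ⟨n, m, hne, he⟩ := Finite.exists_ne_map_eq_of_infinite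
      fun n => {i : Fin k | Z n ∈ L i 0}
    rcases lt_or_gt_of_ne hne with hlt | hlt
    · exact ⟨n, m, hlt, he⟩
    · exact ⟨m, n, hlt, he.symm⟩
  have hrun : ![Z n, X n, enc c ++ [h], Y n] ∈ (runConstraint Teq Tstep).language := by
    rw [mem_language_runConstraint, hTeq, hTstep]
    exact ⟨by simp [Z], relStar_history step enc h n c fun j _ => hc j⟩
  obtain ⟨i, hi⟩ := hsub hrun
  have hshift : ![Z m, X n, enc c ++ [h], Y n] ∈
      (shiftConstraint Tlt Tpre (enc c ++ [h])).language := by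
    rw [mem_language_shiftConstraint, hTlt, hTpre]
    refine ⟨rfl, ?_, ?_⟩
    · simpa [Z] using length_history_strictMono step enc h c hnm
    · change X n <+: history step enc h (n + 1) c
      rw [history_succ]
      exact List.prefix_append _ _
  have hmem : i ∈ {i : Fin k | Z m ∈ L i 0} := hZ ▸ (hi 0 : Z n ∈ L i 0)
  refine Set.eq_empty_iff_forall_notMem.1 hdisj _ ⟨⟨i, fun j => ?_⟩, hshift⟩
  fin_cases j
  exacts [hmem, hi 1, hi 2, hi 3]

/-- If the run is finite, then the prefixes of a sufficiently large length `N` separate the two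
constraints. Indeed, if solutions `u` of the first and `u'` of the second constraint have the same
prefixes of length `N`, then longer and longer histories are prefixes of `u 1` and `u' 1`: the first
constraint transfers a history to `u 3` with a shift by one step, and the second one moves it back
to `u' 1`, unless `u' 1` is shorter than the history. In that case `u 1 = u' 1`, and the lengths of
`u 0` and `u' 0` contradict the constraints. So `u 1` would start with a history that contains the
final configuration, which has no successor. -/
theorem REGSeparable_of_finite [Finite α] (henc : Function.Injective enc) (hh : ∀ c, h ∉ enc c)
    (hTeq : ∀ p q, (p, q) ∈ Teq.relation ↔ p.length = q.length)
    (hTlt : ∀ p q, (p, q) ∈ Tlt.relation ↔ q.length < p.length)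
    (hTpre : ∀ p q, (p, q) ∈ Tpre.relation ↔ p <+: q)
    (hTstep : ∀ p q, (p, q) ∈ Tstep.relation ↔ RelStar (BlockStep step enc h) p q)
    (c : C) {H : ℕ} (hH : step ((advance step)^[H] c) = none) :
    REGSeparable (runConstraint Teq Tstep) (shiftConstraint Tlt Tpre (enc c ++ [h])) := by
  set N := (history step enc h (H + 1) c).length + 1 with hN
  refine ⟨_, isREG_of_forall_take_eq N
    ((fun (u : Fin 4 → List α) j => (u j).take N) '' (runConstraint Teq Tstep).language),
    fun u hu => ⟨u, hu, rfl⟩, ?_⟩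
  rw [Set.eq_empty_iff_forall_notMem]
  rintro u' ⟨⟨u, hu, htake⟩, hu'⟩
  rw [mem_language_runConstraint, hTeq, hTstep] at hu
  rw [mem_language_shiftConstraint, hTlt, hTpre] at hu'
  obtain ⟨hlen, hrun⟩ := hu
  obtain ⟨hv, hlen', hpre⟩ := hu'
  rw [hv] at hpre
  have htake : ∀ j, (u j).take N = (u' j).take N := fun j => congrFun htake j
  have heq : ∀ j, (u j).length < N → u' j = u j := by
    intro j hj
    have h₁ := htake j
    rw [List.take_of_length_le hj.le] at h₁
    have h₂ := congrArg List.length h₁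
    rw [List.length_take] at h₂
    rw [h₁, List.take_of_length_le (by omega)]
  have hprefix : ∀ j, ∀ p : List α, p.length < N → (p <+: u j ↔ p <+: u' j) := by
    intro j p hp
    have : ∀ l : List α, p <+: l.take N ↔ p <+: l := fun l => by
      rw [List.prefix_take_iff]
      exact and_iff_left hp.le
    rw [← this, htake, this]
  have hshort : ∀ n ≤ H + 1, (history step enc h n c).length < N := fun n hn => by
    have := (length_history_strictMono step enc h c).monotone hn
    change _ ≤ (history step enc h (H + 1) c).length at this
    omega
  have key : ∀ n ≤ H + 1, history step enc h n c <+: u 1 := by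
    intro n
    induction n with
    | zero => intro _; simp [history]
    | succ n ih =>
      intro hn
      have h₁ := (hrun.history_prefix henc hh n c (ih (by omega))).1
      have hlt := hshort _ hn
      have h₂ : history step enc h (n + 1) c <+: (enc c ++ [h]) ++ u' 3 := by
        rw [history]
        refine (List.prefix_append_right_inj _).2 ((hprefix 3 _ ?_).1 h₁)
        rw [history, List.length_append] at hlt
        omega
      rcases List.prefix_or_prefix_of_prefix h₂ hpre with h₃ | h₃
      · exact (hprefix 1 _ hlt).2 h₃
      · -- `u' 1` is short, so it equals `u 1`, and `u 0` has the same length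
        have hlt' : (u' 1).length < N := h₃.length_le.trans_lt hlt
        have h₄ : (u 1).length < N := by
          have h₅ := congrArg List.length (htake 1)
          rw [List.length_take, List.length_take] at h₅
          omega
        have h₅ := heq 1 h₄
        have h₆ := heq 0 (by omega)
        rw [h₅, h₆] at hlen'
        omega
  exact (hrun.history_prefix henc hh _ c (key (H + 1) le_rfl)).2 H (Nat.lt_succ_self H) hH

end Separability

/-! ### Configurations of a Turing machine as words -/

/-- A configuration of a Turing machine with finite lists of letters instead of infinite tapes: the
head scans the letter `a`, the letters next to it are `b` on the left and `c` on the right, and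
then follow the lists `l` and `r`, where the letter closest to the head comes first. -/
structure WordCfg (Γ Q : Type) where
  l : List Γ
  b : Γ
  q : Q
  a : Γ
  c : Γ
  r : List Γ

theorem listBlank_mk_append_default {Γ : Type} [Inhabited Γ] (l : List Γ) :
    ListBlank.mk (l ++ [default]) = ListBlank.mk l :=
  Quotient.sound' (Or.inr ⟨1, rfl⟩)

theorem exists_append_singleton_eq_cons {β : Type} (l : List β) (d : β) :
    ∃ x t, l ++ [d] = x :: t := by
  cases l with
  | nil => exact ⟨d, [], rfl⟩
  | cons x t => exact ⟨x, t ++ [d], rfl⟩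

namespace WordCfg

variable {Γ Q α : Type}

/-- The letters of words that encode configurations are the tape letters and the pairs of a state
and a scanned letter, and `none` is kept as a separator. The function `e` assigns letters of the
alphabet `α` to them. -/
def toWord (e : Option (Γ ⊕ Q × Γ) → α) (C : WordCfg Γ Q) : List α :=
  (C.l.reverse ++ [C.b]).map (fun x => e (some (.inl x))) ++
    e (some (.inr (C.q, C.a))) :: (C.c :: C.r).map (fun x => e (some (.inl x)))

variable {e : Option (Γ ⊕ Q × Γ) → α}

theorem toWord_injective (he : Function.Injective e) :
    Function.Injective (toWord (Γ := Γ) (Q := Q) e) := by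
  rintro ⟨l, b, q, a, c, r⟩ ⟨l', b', q', a', c', r'⟩ h
  have hinj : Function.Injective fun x : Γ => e (some (.inl x)) := fun x y hxy => by
    simpa using he hxy
  have hP : ∀ s : List Γ, ∀ x ∈ s.map (fun x => e (some (.inl x))),
      ¬ ∃ p, x = e (some (.inr p)) := by
    simp only [List.mem_map]
    rintro s _ ⟨x, -, rfl⟩ ⟨p, hp⟩
    simpa using he hp
  obtain ⟨h₁, h₂, h₃⟩ := StringConstraints.append_cons_inj (hP _) (hP _) ⟨_, rfl⟩ ⟨_, rfl⟩ h
  have h₁ := List.map_injective_iff.2 hinj h₁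
  have h₃ := List.map_injective_iff.2 hinj h₃
  have h₂ := he h₂
  have h₁ := List.append_inj' h₁ rfl
  simp_all

theorem separator_notMem_toWord (he : Function.Injective e) (C : WordCfg Γ Q) :
    e none ∉ C.toWord e := by
  simp [toWord, he.eq_iff]

variable [Inhabited Γ] [Inhabited Q] (M : TM0.Machine Γ Q)

/-- One step of the machine. A blank is added at both ends, so that the head never reaches the end
of a list. -/
def step (C : WordCfg Γ Q) : Option (WordCfg Γ Q) :=
  (M C.q C.a).map fun p => match p.2 with
    | .write a => ⟨C.l ++ [default], C.b, p.1, a, C.c, C.r ++ [default]⟩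
    | .move .right => ⟨C.b :: (C.l ++ [default]), C.a, p.1, C.c, (C.r ++ [default]).headI,
        (C.r ++ [default]).tail⟩
    | .move .left => ⟨(C.l ++ [default]).tail, (C.l ++ [default]).headI, p.1, C.b, C.a,
        C.c :: (C.r ++ [default])⟩

/-- The configuration in the sense of Mathlib. -/
def toCfg (C : WordCfg Γ Q) : TM0.Cfg Γ Q :=
  ⟨C.q, ⟨C.a, ListBlank.mk (C.b :: C.l), ListBlank.mk (C.c :: C.r)⟩⟩

theorem step_toCfg (C : WordCfg Γ Q) : TM0.step M C.toCfg = (C.step M).map toCfg := by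
  obtain ⟨l, b, q, a, c, r⟩ := C
  obtain ⟨x, s, hx⟩ := exists_append_singleton_eq_cons l (default : Γ)
  obtain ⟨y, t, hy⟩ := exists_append_singleton_eq_cons r (default : Γ)
  have hl : ListBlank.mk (x :: s) = ListBlank.mk l := by rw [← hx, listBlank_mk_append_default]
  have hr : ListBlank.mk (y :: t) = ListBlank.mk r := by rw [← hy, listBlank_mk_append_default]
  have hl₁ : ∀ z, ListBlank.mk (z :: x :: s) = ListBlank.mk (z :: l) := fun z => by
    rw [← ListBlank.cons_mk, hl, ListBlank.cons_mk]
  have hr₁ : ∀ z, ListBlank.mk (z :: y :: t) = ListBlank.mk (z :: r) := fun z => by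
    rw [← ListBlank.cons_mk, hr, ListBlank.cons_mk]
  have hl₂ : ∀ z, ListBlank.mk (z :: b :: x :: s) = ListBlank.mk (z :: b :: l) := fun z => by
    rw [← ListBlank.cons_mk, hl₁, ListBlank.cons_mk]
  have hr₂ : ∀ z, ListBlank.mk (z :: c :: y :: t) = ListBlank.mk (z :: c :: r) := fun z => by
    rw [← ListBlank.cons_mk, hr₁, ListBlank.cons_mk]
  rcases hM : M q a with _ | ⟨q', (_ | _) | a'⟩ <;>
    simp [TM0.step, toCfg, step, hM, hx, hy, Tape.move, Tape.write, hl, hr, hl₁, hr₁,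
      hl₂, hr₂, ListBlank.cons_mk]

/-- The initial configuration for the nonempty input `a :: l`. -/
def init (a : Γ) (l : List Γ) : WordCfg Γ Q :=
  ⟨[], default, default, a, (l ++ [default]).headI, (l ++ [default]).tail⟩

theorem eval_step_init_dom (a : Γ) (l : List Γ) :
    (StateTransition.eval (step M) (init a l)).Dom ↔ (TM0.eval M (a :: l)).Dom := by
  have hresp : StateTransition.Respects (step M) (TM0.step M) fun C c => toCfg C = c := by
    refine StateTransition.fun_respects.2 fun C => ?_
    have h := step_toCfg M C
    cases hC : step M C with
    | none => simpa [StateTransition.FRespects, hC] using h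
    | some C' =>
      rw [hC] at h
      exact Relation.TransGen.single h
  refine (StateTransition.tr_eval_dom hresp (a₂ := TM0.init (a :: l)) ?_).symm
  obtain ⟨y, t, hy⟩ := exists_append_singleton_eq_cons l (default : Γ)
  have hr : ListBlank.mk (y :: t) = ListBlank.mk l := by rw [← hy, listBlank_mk_append_default]
  have hd : ListBlank.mk [(default : Γ)] = ListBlank.mk [] := listBlank_mk_append_default []
  simp [toCfg, init, TM0.init, Tape.mk₁, Tape.mk₂, Tape.mk', hy, hr, hd]

/-- The local change of the word at the head, in a step. -/
def rule (e : Option (Γ ⊕ Q × Γ) → α) (i : Γ × Q × Γ × Γ) : Option (List α) :=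
  (M i.2.1 i.2.2.1).map fun p => match p.2 with
    | .write a => [e (some (.inl i.1)), e (some (.inr (p.1, a))), e (some (.inl i.2.2.2))]
    | .move .right =>
        [e (some (.inl i.1)), e (some (.inl i.2.2.1)), e (some (.inr (p.1, i.2.2.2)))]
    | .move .left =>
        [e (some (.inr (p.1, i.1))), e (some (.inl i.2.2.1)), e (some (.inl i.2.2.2))]

theorem map_toWord_step (C : WordCfg Γ Q) :
    (C.step M).map (toWord e) = (rule M e (C.b, C.q, C.a, C.c)).map fun s =>
      [e (some (.inl default))] ++ (C.l.reverse.map (fun x => e (some (.inl x))) ++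
        (s ++ (C.r.map (fun x => e (some (.inl x))) ++ [e (some (.inl default))]))) := by
  obtain ⟨l, b, q, a, c, r⟩ := C
  obtain ⟨x, s, hx⟩ := exists_append_singleton_eq_cons l (default : Γ)
  obtain ⟨y, t, hy⟩ := exists_append_singleton_eq_cons r (default : Γ)
  have hl : s.reverse ++ [x] = default :: l.reverse := by
    rw [← List.reverse_cons, ← hx, List.reverse_append]; rfl
  have hl' : ∀ z, (s.map fun x => e (some (.inl x))).reverse ++ e (some (.inl x)) :: z =
      e (some (.inl default)) :: ((l.map fun x => e (some (.inl x))).reverse ++ z) := fun z => by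
    simpa using congrArg (fun w => w.map (fun x => e (some (.inl x))) ++ z) hl
  have hy' := congrArg (List.map fun x => e (some (.inl x))) hy
  simp only [List.map_append, List.map_cons, List.map_nil] at hy'
  rcases hM : M q a with _ | ⟨q', (_ | _) | a'⟩
  · simp [step, rule, hM]
  · simp [step, rule, hM, toWord, hx, hl']
  · simp [step, rule, hM, toWord, ← hy', hy]
  · simp [step, rule, hM, toWord]

theorem isRational_blockStep [Finite Γ] [Finite Q] [Finite α] :
    IsRational (BlockStep (step M) (toWord e) (e none)) := by
  let sym : Γ → α := fun x => e (some (.inl x))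
  let lhs : Γ × Q × Γ × Γ → List α := fun i =>
    [e (some (.inl i.1)), e (some (.inr (i.2.1, i.2.2.1))), e (some (.inl i.2.2.2))]
  have hrule := isRational_finite (ι := {i // (rule M e i).isSome})
    (fun i => lhs i.1) (fun i => (rule M e i.1).get i.2)
  have hstart := isRational_finite (ι := Unit) (fun _ => []) (fun _ => [sym default])
  have hend := isRational_finite (ι := Unit) (fun _ => [e none]) (fun _ => [sym default, e none])
  have hcopy := isRational_eq_of_mem_range sym
  refine (hstart.mul (hcopy.mul (hrule.mul (hcopy.mul hend)))).of_iff fun p q => ⟨?_, ?_⟩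
  · rintro ⟨C, C', hC, rfl, rfl⟩
    have h := map_toWord_step (e := e) M C
    rw [hC, Option.map_some] at h
    obtain ⟨s, hs, hsC⟩ := Option.map_eq_some_iff.1 h.symm
    refine ⟨[], _, [sym default], _, ⟨(), rfl, rfl⟩, ⟨C.l.reverse.map sym, _,
      C.l.reverse.map sym, _, ⟨_, rfl, rfl⟩, ⟨lhs (C.b, C.q, C.a, C.c), _, s, _,
      ⟨⟨_, by rw [hs]; rfl⟩, rfl, by simp [hs]⟩, ⟨C.r.map sym, _, C.r.map sym, _,
      ⟨_, rfl, rfl⟩, ⟨(), rfl, rfl⟩, rfl, rfl⟩, rfl, rfl⟩, rfl, rfl⟩, ?_, ?_⟩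
    · simp [toWord, sym, lhs]
    · rw [← hsC]
      simp [sym]
  · rintro ⟨_, _, _, _, ⟨-, rfl, rfl⟩, ⟨_, _, _, _, ⟨l, rfl, rfl⟩, ⟨_, _, _, _,
      ⟨⟨⟨b, q, a, c⟩, hi⟩, rfl, rfl⟩, ⟨_, _, _, _, ⟨r, rfl, rfl⟩, ⟨-, rfl, rfl⟩, rfl, rfl⟩,
      rfl, rfl⟩, rfl, rfl⟩, rfl, rfl⟩
    obtain ⟨s, hs⟩ := Option.isSome_iff_exists.1 hi
    have h := map_toWord_step (e := e) M ⟨l.reverse, b, q, a, c, r⟩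
    rw [hs, Option.map_some] at h
    obtain ⟨C', hC', hCs⟩ := Option.map_eq_some_iff.1 h
    refine ⟨_, C', hC', ?_, ?_⟩
    · simp [toWord, sym, lhs]
    · rw [hCs]
      simp [hs, sym]

theorem toWord_init (a : Γ) (l : List Γ) : (init a l).toWord e =
    e (some (.inl default)) :: e (some (.inr (default, a))) ::
      (l.map (fun x => e (some (.inl x))) ++ [e (some (.inl default))]) := by
  obtain ⟨y, t, hy⟩ := exists_append_singleton_eq_cons l (default : Γ)
  have hy' := congrArg (List.map fun x => e (some (.inl x))) hy
  simp only [List.map_append, List.map_cons, List.map_nil] at hy'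
  simp [toWord, init, hy, hy']

end WordCfg

/-! ### Computability of the reduction -/

theorem primrec_word {β : Type} [Primcodable β] : Primrec (FSA.word : List β → FSA β) := by
  have htr : Primrec fun w : List β => (List.range w.length).map fun i => (i, w[i]?, i + 1) :=
    Primrec.list_map (Primrec.list_range.comp Primrec.list_length)
      (Primrec.pair Primrec.snd (Primrec.pair
        (Primrec.list_getElem?.comp Primrec.fst Primrec.snd) (Primrec.succ.comp Primrec.snd)))
  exact (Primrec.of_equiv_symm (e := FSA.equivProd β)).comp (htr.pair
    ((Primrec.const [0]).pair (Primrec.list_cons.comp Primrec.list_length (Primrec.const []))))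

theorem primrec_shiftConstraint {α : Type} [Primcodable α] (T₁ T₂ : Transducer α) :
    Primrec (shiftConstraint T₁ T₂) :=
  Primrec.list_cons.comp
    ((Primrec.of_equiv_symm (e := Atomic.equivSum α 4)).comp
      (Primrec.sumInl.comp ((Primrec.const 2).pair primrec_word)))
    (Primrec.const _)

end StringConstraints

open StringConstraints in
/-- For some finite alphabet `Fin m` and some number `n` of string variables, no algorithm decides
`REG`-separability of two given straight-line string constraints; the algorithm may do anything,
including diverge, on inputs that are not straight-line. -/
theorem mainTheorem1 :
    ∃ m n : ℕ,
      ¬ ∃ f : StringConstraints.Constraint (Fin m) n × StringConstraints.Constraint (Fin m) n →. Bool,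
        Partrec f ∧
        ∀ Ψ Ψ' : StringConstraints.Constraint (Fin m) n,
          Ψ.IsStraightLine → Ψ'.IsStraightLine →
            ∃ b ∈ f (Ψ, Ψ'), (b = true ↔ StringConstraints.REGSeparable Ψ Ψ') := by
  obtain ⟨Γ, Q, _, _, _, _, M, a, g, hM⟩ := exists_turingMachine_halting_undecidable
  obtain ⟨m, ⟨e⟩⟩ := Finite.exists_equiv_fin (Option (Γ ⊕ Q × Γ))
  refine ⟨m, 4, ?_⟩
  rintro ⟨f, hf, hfsep⟩
  apply hM
  obtain ⟨Teq, hTeq⟩ := (isRational_length_eq (α := Fin m)).exists_transducer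
  obtain ⟨Tlt, hTlt⟩ := (isRational_length_lt (α := Fin m)).exists_transducer
  obtain ⟨Tpre, hTpre⟩ := (isRational_prefix (α := Fin m)).exists_transducer
  obtain ⟨Tstep, hTstep⟩ := (WordCfg.isRational_blockStep (e := e) M).star.exists_transducer
  let C : ℕ → WordCfg Γ Q := fun k => WordCfg.init a (k.bits.reverse.map g)
  let F : ℕ → Constraint (Fin m) 4 × Constraint (Fin m) 4 := fun k =>
    (runConstraint Teq Tstep, shiftConstraint Tlt Tpre ((C k).toWord e ++ [e none]))
  have hsep : ∀ k, REGSeparable (F k).1 (F k).2 ↔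
      (TM0.eval M (a :: (k.bits.reverse.map g))).Dom := by
    intro k
    rw [← WordCfg.eval_step_init_dom, eval_dom_iff_exists_step_eq_none]
    constructor
    · intro h
      by_contra hc
      exact not_REGSeparable_of_infinite hTeq hTlt hTpre hTstep (C k)
        (fun n hn => hc ⟨n, hn⟩) h
    · rintro ⟨H, hH⟩
      exact REGSeparable_of_finite (WordCfg.toWord_injective e.injective)
        (WordCfg.separator_notMem_toWord e.injective) hTeq hTlt hTpre hTstep (C k) hH
  have hF : Computable F := by
    have hword : Primrec fun k : ℕ => (C k).toWord e ++ [e none] := by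
      simp only [C, WordCfg.toWord_init, List.map_map]
      exact Primrec.list_append.comp (Primrec.list_cons.comp (Primrec.const _)
        (Primrec.list_cons.comp (Primrec.const _) (Primrec.list_append.comp
          (Primrec.list_map (Primrec.list_reverse.comp Primrec.nat_bits)
            ((Primrec.dom_finite _).comp Primrec.snd)) (Primrec.const _)))) (Primrec.const _)
    exact ((Primrec.const _).pair ((primrec_shiftConstraint _ _).comp hword)).to_comp
  have htotal : ∀ k, ∃ b ∈ f (F k), (b = true ↔ REGSeparable (F k).1 (F k).2) := fun k =>
    hfsep _ _ (runConstraint_isStraightLine _ _) (shiftConstraint_isStraightLine _ _ _)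
  choose d hd hdsep using htotal
  refine ComputablePred.computable_iff.2 ⟨d, (hf.comp hF).of_eq fun k => ?_, ?_⟩
  · exact Part.eq_some_iff.2 (hd k)
  · funext k
    exact propext ((hsep k).symm.trans (hdsep k).symm)
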